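/- **Conventions.** Consider the triangular grid as the projection of the cubical tessellation of $\mathbb{R}^3$ along the direction $(1,1,1)$: unit squares project to lozenges (unions of two adjacent unit triangles) and unit cubes project to unit hexagons. A tiling of a finite union $\mathcal D$ of triangles of the grid is a set of lozenges with pairwise disjoint interiors and union $\mathcal D$. The unit hexagon has two tilings by three lozenges; a down-flip replaces, inside a tiling, the one in which the three upper faces of a cube are seen by the one in which the three lower faces are seen. A pile is a finite set of unit cubes in the octant $\mathbb{Z}_{\ge 0}^3$, a cube being encoded by its lowest corner. A pile is *compact* if for each of its cubes $(i_0,j_0,k_0)$ it contains all cubes $(i,j_0,k_0)$, $(i_0,j,k_0)$, $(i_0,j_0,k)$ with $0\le i\le i_0$, $0\le j\le j_0$, $0\le k\le k_0$. A *pseudo-hexagon* $\mathcal D$ is the domain obtained by starting from a compact pile, viewed from the direction $(1,1,1)$, and performing all possible down-flips. A pile is *in* $\mathcal D$ if all its cubes project into $\mathcal D$. It is put on the base squares, i.e. the squares of the three coordinate planes of the octant that project into $\mathcal D$. The pile *corresponds* to a tiling $T$ of $\mathcal D$ if the uncovered squares (those faces of cubes of the pile which look in a positive axis direction and are not shared with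 another cube of the pile, and the base squares on which no cube of the pile stands) are projected one-to-one onto the lozenges of $T$. A plane partition is a filling of a Ferrers diagram with positive integers that is non-increasing along rows and columns; $A\le B$ means $A_{ij}\le B_{ij}$ for all $i,j$, with entries outside the diagram counted as $0$. The pile of $A$ is $\{(i,j,k): 0\le k<A_{ij}\}$. **Proposition.** Let $\mathcal D$ be a pseudo-hexagon. 1. A pile of cubes in $\mathcal D$ corresponds to a tiling of $\mathcal D$ if and only if it is compact. 2. A pile is compact if and only if every section of it by a plane orthogonal to one of the axes is a (possibly empty) Ferrers diagram. 3. The empty pile corresponds to a tiling of $\mathcal D$ on which no down-flip is possible. 4. There is a plane partition $B$ whose pile defines $\mathcal D$ as a pseudo-hexagon and is the greatest compact pile in $\mathcal D$. Taking piles is a bijection from the plane partitions $A\le B$ onto the compact piles in $\mathcal D$, and there is a bijection from the plane partitions $A\le B$ onto the tilings of $\mathcal D$ under which the pile of $A$ corresponds to the tiling assigned to $A$. -/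

import Mathlib

namespace LozengeTiling

/-! ### The triangular grid and lozenges

The vertices of the triangular grid are the points of `ℤ × ℤ`, the coordinates being taken with
respect to two unit vectors `a`, `b` at an angle of 120 degrees; `c = -a-b` is the third unit vector
of the grid with `a + b + c = 0`. -/

/-- The three positive directions `a`, `b`, `c` of the triangular grid: the projections along
`(1,1,1)` of the three unit vectors of `ℤ³`. -/
def dir : Fin 3 → ℤ × ℤ := ![(1, 0), (0, 1), (-1, -1)]

/-- The unit triangles of the grid, of both orientations. -/
inductive Triangle where
  | up (v : ℤ × ℤ)
  | down (v : ℤ × ℤ)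

/-- The vertices of a triangle: `v, v + a, v + a + b` and `v, v + b, v + a + b`. -/
def Triangle.vertices : Triangle → Set (ℤ × ℤ)
  | .up v => {v, v + (1, 0), v + (1, 1)}
  | .down v => {v, v + (0, 1), v + (1, 1)}

/-- The lozenge with vertices `v`, `v + e`, `v + f`, `v + e + f`, where `v` is the corner and `e`,
`f` are the two positive directions other than `dir axis`. There are three kinds of lozenges,
one for each value of `axis`. -/
@[ext] structure Lozenge where
  axis : Fin 3
  corner : ℤ × ℤ

/-- The two triangles that a lozenge is made of. -/
def Lozenge.cells (l : Lozenge) : Set Triangle :=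
  match l.axis with
  | 0 => {.up (l.corner - (1, 0)), .down (l.corner - (1, 1))}
  | 1 => {.up (l.corner - (1, 1)), .down (l.corner - (0, 1))}
  | 2 => {.up l.corner, .down l.corner}

/-- The triangles of a lozenge are `v, v + e, v + e + f` and `v, v + f, v + e + f`. -/
theorem Lozenge.vertices_cells (k : Fin 3) (v : ℤ × ℤ) :
    Triangle.vertices '' (Lozenge.mk k v).cells =
      {{v, v + dir (k + 1), v + dir (k + 1) + dir (k + 2)},
        {v, v + dir (k + 2), v + dir (k + 1) + dir (k + 2)}} := by
  obtain ⟨x, y⟩ := v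
  fin_cases k
  · simp only [Lozenge.cells, Set.image_pair, Triangle.vertices, dir]
    congr 1
    · ext ⟨s, t⟩; simp; grind
    · congr 1; ext ⟨s, t⟩; simp; grind
  · simp only [Lozenge.cells, Set.image_pair, Triangle.vertices, dir]
    congr 1
    · ext ⟨s, t⟩; simp; grind
    · congr 1; ext ⟨s, t⟩; simp; grind
  · simp only [Lozenge.cells, Set.image_pair, Triangle.vertices, dir]
    congr 1
    · ext ⟨s, t⟩; simp
    · congr 1; ext ⟨s, t⟩; simp

/-- The part of the plane (as a set of triangles) covered by a set of lozenges. -/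
def region (T : Set Lozenge) : Set Triangle := ⋃ l ∈ T, l.cells

/-- `T` is a tiling of the domain `D` (a set of triangles): its lozenges have pairwise disjoint
interiors, and their union is `D`. -/
def IsTiling (D : Set Triangle) (T : Set Lozenge) : Prop :=
  T.PairwiseDisjoint Lozenge.cells ∧ region T = D

/-- `T'` is obtained from `T` by a down-flip: three lozenges of `T` that cover the unit hexagon
with centre `v`, all edges at `v` being directed towards `v` (so that the height is maximal at `v`),
are replaced by the three lozenges of the other tiling of that hexagon, where all edges at `v` are
directed away from `v`. -/
def DownFlip (T T' : Set Lozenge) : Prop :=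
  ∃ v : ℤ × ℤ, (∀ k, (⟨k, v + dir k⟩ : Lozenge) ∈ T) ∧
    T' = (T \ Set.range fun k => (⟨k, v + dir k⟩ : Lozenge)) ∪
      Set.range fun k => (⟨k, v⟩ : Lozenge)

/-! ### Cubes, squares, and their projections -/

/-- A unit cube of the cubical tessellation of the positive octant, given by its lowest corner. -/
abbrev Cube := Fin 3 → ℕ

/-- A unit square (2-cell) of the cubical tessellation: the square orthogonal to the axis `axis`
whose lowest corner is `corner`. -/
@[ext] structure Square where
  axis : Fin 3
  corner : Fin 3 → ℕ

/-- The projection along `(1,1,1)` onto the triangular grid. -/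
def proj (p : Fin 3 → ℕ) : ℤ × ℤ := ((p 0 : ℤ) - p 2, (p 1 : ℤ) - p 2)

/-- The projection of a square along `(1,1,1)`, a lozenge. -/
def Square.toLozenge (s : Square) : Lozenge := ⟨s.axis, proj s.corner⟩

/-- The projection of a cube along `(1,1,1)`: a unit hexagon, covered by the projections of the
three lower faces of the cube. -/
def hexagon (p : Cube) : Set Triangle :=
  region (Set.range fun k => (⟨k, p⟩ : Square).toLozenge)

/-- A pile is a set of cubes. It is compact if with every cube it contains all the cubes between
that cube and the coordinate planes, in the three directions of the axes. -/
def IsCompactPile (P : Set Cube) : Prop :=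
  ∀ p ∈ P, ∀ k : Fin 3, ∀ i ≤ p k, Function.update p k i ∈ P

/-- The faces of a pile that look in the directions of the axes and are not covered by
a cube of the pile: `p + Pi.single k 1` is the next cube after `p` in the direction `k`, and also
the lowest corner of the square between the two. -/
def visibleFaces (P : Set Cube) : Set Square :=
  {s | ∃ p ∈ P, s.corner = p + Pi.single s.axis 1 ∧ s.corner ∉ P}

/-- `D` is the domain obtained from the finite compact pile `Q` (seen from the direction `(1,1,1)`)
by performing all the possible down-flips. -/
def IsPseudoHexagonOf (Q : Set Cube) (D : Set Triangle) : Prop :=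
  Q.Finite ∧ IsCompactPile Q ∧ ∃ T₀ : Set Lozenge,
    Relation.ReflTransGen DownFlip (Square.toLozenge '' visibleFaces Q) T₀ ∧
    (∀ T', ¬ DownFlip T₀ T') ∧ D = region T₀

/-- A pseudo-hexagon. -/
def IsPseudoHexagon (D : Set Triangle) : Prop := ∃ Q : Set Cube, IsPseudoHexagonOf Q D

/-- `P` is a (finite) pile of cubes in the domain `D`. -/
def IsPileIn (D : Set Triangle) (P : Set Cube) : Prop :=
  P.Finite ∧ ∀ p ∈ P, hexagon p ⊆ D

/-- The base squares of a pseudo-hexagon, on which cubes can be put: the squares of the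
three coordinate planes of the octant that project into the domain. -/
def baseSquares (D : Set Triangle) : Set Square :=
  {s | s.corner s.axis = 0 ∧ s.toLozenge.cells ⊆ D}

/-- The squares that remain uncovered when the pile `P` is put on the base squares of `D`: those
faces of the pile, and those base squares, on which no cube of the pile stands. -/
def surface (D : Set Triangle) (P : Set Cube) : Set Square :=
  visibleFaces P ∪ {s ∈ baseSquares D | s.corner ∉ P}

/-- The pile `P` corresponds to the set of lozenges `T`: projecting the uncovered squares along
`(1,1,1)` gives exactly the lozenges of `T`, each of them once. -/
def CorrespondsTo (D : Set Triangle) (P : Set Cube) (T : Set Lozenge) : Prop :=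
  Set.BijOn Square.toLozenge (surface D P) T

/-! ### Ferrers diagrams and plane partitions -/

/-- `S` is the Ferrers diagram of a partition `l`, that is, of a non-increasing list of positive
integers: row `i` consists of the squares `(i, 0), …, (i, lᵢ - 1)`. -/
def IsFerrersDiagram (S : Set (ℕ × ℕ)) : Prop :=
  ∃ l : List ℕ, l.Pairwise (· ≥ ·) ∧ (∀ x ∈ l, 0 < x) ∧ S = {c | c.2 < l.getD c.1 0}

/-- The section of a pile by a plane orthogonal to the axis `k` (through the layer of cubes
whose `k`-th coordinate is `n`). -/
def layer (P : Set Cube) (k : Fin 3) (n : ℕ) : Set (ℕ × ℕ) :=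
  {c | ∃ p ∈ P, p k = n ∧ p (k + 1) = c.1 ∧ p (k + 2) = c.2}

/-- A plane partition: a filling of a Ferrers diagram with positive integers, non-increasing
along the rows and the columns. Outside its diagram it is extended by zero. -/
structure PlanePartition where
  shape : Set (ℕ × ℕ)
  shape_ferrers : IsFerrersDiagram shape
  entry : ℕ → ℕ → ℕ
  entry_pos : ∀ i j, (i, j) ∈ shape → 0 < entry i j
  entry_zero : ∀ i j, (i, j) ∉ shape → entry i j = 0
  row_le : ∀ i j j', (i, j) ∈ shape → (i, j') ∈ shape → j ≤ j' → entry i j' ≤ entry i j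
  col_le : ∀ i i' j, (i, j) ∈ shape → (i', j) ∈ shape → i ≤ i' → entry i' j ≤ entry i j

/-- The order on plane partitions, entry by entry: `A` is bounded by `B`. -/
def PlanePartition.BoundedBy (A B : PlanePartition) : Prop :=
  ∀ i j, A.entry i j ≤ B.entry i j

/-- The pile of cubes of a plane partition: a column of `A.entry i j` cubes on the square `(i, j)`
of the horizontal coordinate plane. -/
def PlanePartition.pile (A : PlanePartition) : Set Cube :=
  {p | p 2 < A.entry (p 0) (p 1)}

end LozengeTiling

namespace LozengeTiling

/-! ### Tilings of the plane and height functions -/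

/-! A tiling of the whole plane is the same as a height function up to a constant. Lift an edge in
direction `k` to the unit vector in direction `k`, or to that vector minus `(1,1,1)` if the edge is
a diagonal of a lozenge. Around a triangle the third coordinates then sum to `1` minus the number of
lozenges covering it, so closedness means that each triangle is covered exactly once
(`IsHeight.isTiling`, `exists_isHeight`).

A finite compact pile on the three walls of the octant has a height: the first point on each
diagonal that is not in the pile. Hence its whole surface, walls included, projects to a tiling of
the plane (`isTiling_fullSurface`). Down-flips preserve the covered region, so D is `domain Q` for
the given pile `Q`, and the wall squares not covered by `Q` tile its complement. Tilings of D are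
therefore the plane tilings extending these fixed outer lozenges. Outside D their heights, suitably
normalized, equal those of the walls, which forces them to be surfaces of compact piles inside
`maxPile Q` (`exists_pile_of_isTiling`), and distinct piles have distinct heights
(`eq_of_image_surface_eq`).

Conversely, a pile corresponding to a tiling has no gaps, by counting: in each axis direction there
are as many lozenges as columns, while every column shows at least one uncovered square
(`isCompactPile_of_correspondsTo`). Removing maximal cubes is a sequence of down-flips ending at the
empty pile, where no flip remains. Finally, finite compact piles are the piles of plane partitions.
-/

theorem isTiling_iff {D : Set Triangle} {T : Set Lozenge} :
    IsTiling D T ↔ (∀ l ∈ T, l.cells ⊆ D) ∧ ∀ t ∈ D, ∃! l, l ∈ T ∧ t ∈ l.cells := by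
  constructor
  · rintro ⟨hd, rfl⟩
    refine ⟨fun l hl => Set.subset_biUnion_of_mem (u := Lozenge.cells) hl, fun t ht => ?_⟩
    obtain ⟨l, hl, htl⟩ := Set.mem_iUnion₂.1 ht
    exact ⟨l, ⟨hl, htl⟩, fun l' h' => hd.elim_set h'.1 hl t h'.2 htl⟩
  · rintro ⟨h1, h2⟩
    refine ⟨fun l hl l' hl' hne => Set.disjoint_left.2 fun t ht ht' => hne ?_, ?_⟩
    · exact (h2 t (h1 l hl ht)).unique ⟨hl, ht⟩ ⟨hl', ht'⟩
    · refine Set.Subset.antisymm (Set.iUnion₂_subset h1) fun t ht => ?_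
      obtain ⟨l, hl, -⟩ := h2 t ht
      exact Set.mem_iUnion₂.2 ⟨l, hl.1, hl.2⟩

theorem Lozenge.cells_nonempty (l : Lozenge) : l.cells.Nonempty := by
  obtain ⟨k, v⟩ := l
  fin_cases k <;> exact ⟨_, Or.inl rfl⟩

/-- The three candidates correspond to the three edges of the triangle, each being the common edge
of the two triangles of one lozenge. -/
theorem Lozenge.up_mem_cells {l : Lozenge} {v : ℤ × ℤ} :
    Triangle.up v ∈ l.cells ↔
      l = ⟨0, v + dir 0⟩ ∨ l = ⟨1, v + dir 0 + dir 1⟩ ∨ l = ⟨2, v⟩ := by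
  obtain ⟨k, w⟩ := l
  obtain ⟨x, y⟩ := v
  obtain ⟨s, t⟩ := w
  fin_cases k <;> simp [Lozenge.cells, dir] <;> omega

theorem Lozenge.down_mem_cells {l : Lozenge} {v : ℤ × ℤ} :
    Triangle.down v ∈ l.cells ↔
      l = ⟨1, v + dir 1⟩ ∨ l = ⟨0, v + dir 1 + dir 0⟩ ∨ l = ⟨2, v⟩ := by
  obtain ⟨k, w⟩ := l
  obtain ⟨x, y⟩ := v
  obtain ⟨s, t⟩ := w
  fin_cases k <;> simp [Lozenge.cells, dir] <;> omega

/-- The third coordinate of the unit vector in direction `k`. -/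
def lev (k : Fin 3) : ℤ := if k = 2 then 1 else 0

/-- The increment of the height along the edge in direction `k` starting at `v`: the third
coordinate of the lifted edge, lowered by one if the edge is the long diagonal of a lozenge. -/
noncomputable def incr (T : Set Lozenge) (k : Fin 3) (v : ℤ × ℤ) : ℤ :=
  lev k - T.indicator 1 (⟨k, v + dir k⟩ : Lozenge)

/-- `z` is a height function of `T`: the third coordinate of a lift of the vertices of the grid
to `ℤ³` that is compatible with the lozenges of `T`. -/
def IsHeight (z : ℤ × ℤ → ℤ) (T : Set Lozenge) : Prop :=
  ∀ v k, z (v + dir k) = z v + incr T k v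

theorem dir_cycle (v : ℤ × ℤ) : v + dir 0 + dir 1 + dir 2 = v := by
  ext <;> simp [dir]

theorem dir_cycle' (v : ℤ × ℤ) : v + dir 1 + dir 0 + dir 2 = v := by
  ext <;> simp [dir]

theorem incr_le (T : Set Lozenge) (k : Fin 3) (v : ℤ × ℤ) : incr T k v ≤ lev k := by
  have : 0 ≤ T.indicator (1 : Lozenge → ℤ) ⟨k, v + dir k⟩ :=
    Set.indicator_nonneg (fun _ _ => zero_le_one) _
  unfold incr; omega

theorem le_incr (T : Set Lozenge) (k : Fin 3) (v : ℤ × ℤ) : lev k - 1 ≤ incr T k v := by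
  by_cases h : (⟨k, v + dir k⟩ : Lozenge) ∈ T <;> simp [incr, h]

theorem incr_of_mem {T : Set Lozenge} {k : Fin 3} {v : ℤ × ℤ}
    (h : (⟨k, v + dir k⟩ : Lozenge) ∈ T) : incr T k v = lev k - 1 := by
  simp [incr, h]

theorem mem_iff_incr {T : Set Lozenge} {k : Fin 3} {v : ℤ × ℤ} :
    (⟨k, v + dir k⟩ : Lozenge) ∈ T ↔ incr T k v < lev k := by
  by_cases h : (⟨k, v + dir k⟩ : Lozenge) ∈ T <;> simp [incr, h]

theorem existsUnique_mem_iff_indicator {α : Type*} {T : Set α} {a b c : α} (hab : a ≠ b)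
    (hac : a ≠ c) (hbc : b ≠ c) :
    (∃! l, l ∈ T ∧ (l = a ∨ l = b ∨ l = c)) ↔
      T.indicator (1 : α → ℤ) a + T.indicator 1 b + T.indicator 1 c = 1 := by
  constructor
  · rintro ⟨l, ⟨hl, hc⟩, hu⟩
    have ua := hu a
    have ub := hu b
    have uc := hu c
    by_cases a0 : a ∈ T <;> by_cases a1 : b ∈ T <;> by_cases a2 : c ∈ T <;>
      simp [a0, a1, a2] at ua ub uc ⊢ <;> grind
  · intro h
    by_cases a0 : a ∈ T <;> by_cases a1 : b ∈ T <;> by_cases a2 : c ∈ T <;>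
      simp [a0, a1, a2] at h
    · exact ⟨a, by grind⟩
    · exact ⟨b, by grind⟩
    · exact ⟨c, by grind⟩

theorem IsHeight.isTiling {z : ℤ × ℤ → ℤ} {T : Set Lozenge} (h : IsHeight z T) :
    IsTiling Set.univ T := by
  refine isTiling_iff.2 ⟨fun _ _ => Set.subset_univ _, ?_⟩
  rintro (v | v) -
  · simp only [Lozenge.up_mem_cells]
    refine (existsUnique_mem_iff_indicator (by simp) (by simp) (by simp)).2 ?_
    have h0 := h v 0
    have h1 := h (v + dir 0) 1
    have h2 := h (v + dir 0 + dir 1) 2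
    simp only [incr, lev, dir_cycle] at h0 h1 h2
    simp at h0 h1 h2
    omega
  · simp only [Lozenge.down_mem_cells]
    refine (existsUnique_mem_iff_indicator (by simp) (by simp) (by simp)).2 ?_
    have h0 := h v 1
    have h1 := h (v + dir 1) 0
    have h2 := h (v + dir 1 + dir 0) 2
    simp only [incr, lev, dir_cycle'] at h0 h1 h2
    simp at h0 h1 h2
    omega

theorem incr_cycle {T : Set Lozenge} (hT : IsTiling Set.univ T) (v : ℤ × ℤ) :
    incr T 0 v + incr T 1 (v + dir 0) + incr T 2 (v + dir 0 + dir 1) = 0 := by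
  have h := (isTiling_iff.1 hT).2 (.up v) trivial
  simp only [Lozenge.up_mem_cells] at h
  rw [existsUnique_mem_iff_indicator (by simp) (by simp) (by simp)] at h
  simp only [incr, lev, dir_cycle]
  simp
  omega

theorem incr_cycle' {T : Set Lozenge} (hT : IsTiling Set.univ T) (v : ℤ × ℤ) :
    incr T 1 v + incr T 0 (v + dir 1) + incr T 2 (v + dir 1 + dir 0) = 0 := by
  have h := (isTiling_iff.1 hT).2 (.down v) trivial
  simp only [Lozenge.down_mem_cells] at h
  rw [existsUnique_mem_iff_indicator (by simp) (by simp) (by simp)] at h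
  simp only [incr, lev, dir_cycle']
  simp
  omega

theorem exists_sum_int (f : ℤ → ℤ) : ∃ F : ℤ → ℤ, ∀ n, F (n + 1) = F n + f n := by
  refine ⟨fun n => ∑ i ∈ Finset.Ico 0 n, f i - ∑ i ∈ Finset.Ico n 0, f i, fun n => ?_⟩
  rcases le_or_gt 0 n with h | h
  · simp only [Finset.Ico_eq_empty_of_le (show (0 : ℤ) ≤ n + 1 by omega),
      Finset.Ico_eq_empty_of_le h, Finset.sum_empty, sub_zero]
    rw [← Finset.insert_Ico_right_eq_Ico_add_one h, Finset.sum_insert (by simp), add_comm]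
  · simp only [Finset.Ico_eq_empty_of_le (show n + 1 ≤ (0 : ℤ) by omega),
      Finset.Ico_eq_empty_of_le h.le, Finset.sum_empty, zero_sub]
    rw [← Finset.insert_Ico_add_one_left_eq_Ico h, Finset.sum_insert (by simp)]
    ring

/-- A function on the edges of the square grid whose sum around every square vanishes is
the difference of a function on the vertices. -/
theorem exists_potential (f g : ℤ → ℤ → ℤ)
    (h : ∀ x y, f x y + g (x + 1) y = g x y + f x (y + 1)) :
    ∃ F : ℤ → ℤ → ℤ, ∀ x y, F (x + 1) y = F x y + f x y ∧ F x (y + 1) = F x y + g x y := by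
  obtain ⟨F₀, h₀⟩ := exists_sum_int fun x => f x 0
  choose G hG using fun x => exists_sum_int (g x)
  refine ⟨fun x y => F₀ x + (G x y - G x 0), fun x y => ⟨?_, by simp only [hG]; ring⟩⟩
  induction y using Int.induction_on with
  | zero => simp [h₀]
  | succ i ih => have := h x i; simp only [hG] at *; linarith
  | pred i ih =>
    have := h x (-i - 1)
    have h1 := hG x (-i - 1)
    have h2 := hG (x + 1) (-i - 1)
    simp only [sub_add_cancel] at *
    linarith

theorem exists_isHeight {T : Set Lozenge} (hT : IsTiling Set.univ T) : ∃ z, IsHeight z T := by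
  -- The two triangles of a grid square share its edge in direction `2`, so subtracting their cycle
  -- relations gives the relation around the square.
  obtain ⟨F, hF⟩ := exists_potential (fun x y => incr T 0 (x, y)) (fun x y => incr T 1 (x, y))
    (fun x y => by
      have h1 := incr_cycle hT (x, y)
      have h2 := incr_cycle' hT (x, y)
      simp [dir] at h1 h2 ⊢
      omega)
  refine ⟨fun v => F v.1 v.2, fun v k => ?_⟩
  obtain ⟨x, y⟩ := v
  fin_cases k
  · simpa [dir] using (hF x y).1
  · simpa [dir] using (hF x y).2
  · have h1 := incr_cycle hT (x - 1, y - 1)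
    have h2 := (hF (x - 1) (y - 1)).1
    have h3 := (hF x (y - 1)).2
    simp [dir] at h1 h2 h3 ⊢
    rw [← sub_eq_add_neg, ← sub_eq_add_neg]
    omega

theorem IsHeight.sub_const {z : ℤ × ℤ → ℤ} {T : Set Lozenge} (h : IsHeight z T) (c : ℤ) :
    IsHeight (fun v => z v - c) T := fun v k => by simp [h v k]; ring

theorem IsHeight.eq_of_eq {z z' : ℤ × ℤ → ℤ} {T : Set Lozenge} (h : IsHeight z T)
    (h' : IsHeight z' T) (v₀ : ℤ × ℤ) (h₀ : z v₀ = z' v₀) : z = z' := by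
  have hx : ∀ k v, z (v + dir k) - z' (v + dir k) = z v - z' v := fun k v => by
    rw [h, h']; ring
  have hx0 : ∀ x y, z (x + 1, y) - z' (x + 1, y) = z (x, y) - z' (x, y) := fun x y => by
    simpa [dir] using hx 0 (x, y)
  have hx1 : ∀ x y, z (x, y + 1) - z' (x, y + 1) = z (x, y) - z' (x, y) := fun x y => by
    simpa [dir] using hx 1 (x, y)
  have e : ∀ x y, z (x, y) - z' (x, y) = z (0, 0) - z' (0, 0) := fun x y => by
    induction x using Int.induction_on with
    | zero =>
      induction y using Int.induction_on with
      | zero => rfl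
      | succ i ih => rw [hx1, ih]
      | pred i ih => rw [← ih, ← hx1]; simp
    | succ i ih => rw [hx0, ih]
    | pred i ih => rw [← ih, ← hx0]; simp
  funext v
  have := e v.1 v.2
  have := e v₀.1 v₀.2
  simp only [Prod.mk.eta] at *
  omega

theorem IsHeight.set_eq {z : ℤ × ℤ → ℤ} {T T' : Set Lozenge} (h : IsHeight z T)
    (h' : IsHeight z T') : T = T' := by
  ext ⟨k, w⟩
  have h1 := h (w - dir k) k
  have h2 := h' (w - dir k) k
  rw [← sub_add_cancel w (dir k), mem_iff_incr, mem_iff_incr]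
  omega

/-- The edges of a lozenge that start at its corner are not long diagonals. -/
theorem IsHeight.step {z : ℤ × ℤ → ℤ} {T : Set Lozenge} (h : IsHeight z T) {j k : Fin 3}
    {v : ℤ × ℤ} (hj : (⟨j, v⟩ : Lozenge) ∈ T) (hk : k ≠ j) : z (v + dir k) = z v + lev k := by
  -- The edge from `v - dir j` to `v` is lowered. The way back through `v + dir k` must make up the
  -- full `lev k + lev i`, so neither of its two edges can be lowered.
  have key : ∀ i, v + dir k + dir i = v - dir j → lev i + lev k + lev j = 1 →
      z (v + dir k) = z v + lev k := by
    intro i hi hl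
    have h1 := h v k
    have h2 := h (v + dir k) i
    have h3 := h (v - dir j) j
    have e1 := incr_le T k v
    have e2 := incr_le T i (v + dir k)
    rw [← sub_add_cancel v (dir j)] at hj
    rw [incr_of_mem hj] at h3
    rw [hi] at h2
    rw [sub_add_cancel] at h3
    omega
  fin_cases j <;> fin_cases k <;> simp at hk
  · exact key 2 (by ext <;> simp [dir, sub_eq_add_neg, add_assoc]) (by simp [lev])
  · exact key 1 (by ext <;> simp [dir, sub_eq_add_neg, add_assoc]) (by simp [lev])
  · exact key 2 (by ext <;> simp [dir, sub_eq_add_neg, add_assoc]) (by simp [lev])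
  · exact key 0 (by ext <;> simp [dir, sub_eq_add_neg, add_assoc]) (by simp [lev])
  · exact key 1 (by ext <;> simp [dir, sub_eq_add_neg, add_assoc]) (by simp [lev])
  · exact key 0 (by ext <;> simp [dir, sub_eq_add_neg, add_assoc]) (by simp [lev])

theorem IsHeight.le_step {z : ℤ × ℤ → ℤ} {T : Set Lozenge} (h : IsHeight z T) (v : ℤ × ℤ)
    (k : Fin 3) : z (v + dir k) ≤ z v + lev k := by
  have := h v k
  have := incr_le T k v
  omega

/-! ### Piles and heights -/

theorem isCompactPile_iff_isLowerSet {P : Set Cube} : IsCompactPile P ↔ IsLowerSet P := by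
  constructor
  · intro h p q hqp hp
    have h0 := h p hp 0 (q 0) (hqp 0)
    have h1 := h _ h0 1 (q 1) (by simpa using hqp 1)
    have h2 := h _ h1 2 (q 2) (by simpa using hqp 2)
    convert h2 using 1
    ext k
    fin_cases k <;> simp [Function.update]
  · intro h p hp k i hi
    exact h (update_le_iff.2 ⟨hi, fun _ _ => le_rfl⟩) hp

theorem cube_ext {p q : Cube} (h : proj p = proj q) (h2 : p 2 = q 2) : p = q := by
  simp only [proj, Prod.mk.injEq] at h
  ext k
  fin_cases k <;> simp <;> omega

theorem proj_add_single (p : Cube) (k : Fin 3) : proj (p + Pi.single k 1) = proj p + dir k := by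
  fin_cases k <;> ext <;> simp [proj, dir] <;> ring

theorem add_single_two (p : Cube) (k : Fin 3) :
    (((p + Pi.single k 1 : Cube) 2 : ℕ) : ℤ) = p 2 + lev k := by
  fin_cases k <;> simp [lev]

/-- The point of the diagonal over `v` whose third coordinate is `t` is a cube of `P`, unless it
lies outside of the octant. -/
def Solid (P : Set Cube) (v : ℤ × ℤ) (t : ℤ) : Prop :=
  ∀ q : Cube, proj q = v → (q 2 : ℤ) = t → q ∈ P

/-- `z` describes the upper boundary of the pile `P` on the walls of the octant. -/
def IsHeightOf (P : Set Cube) (z : ℤ × ℤ → ℤ) : Prop := ∀ v t, Solid P v t ↔ t < z v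

/-- A cube is determined by its projection and its third coordinate, so for points of the octant
`Solid` is plain membership. -/
theorem solid_proj {P : Set Cube} {q : Cube} : Solid P (proj q) (q 2) ↔ q ∈ P :=
  ⟨fun h => h q rfl rfl, fun h r hr h2 => by rwa [cube_ext hr (by exact_mod_cast h2)]⟩

theorem IsHeightOf.mem_iff {P : Set Cube} {z : ℤ × ℤ → ℤ} (h : IsHeightOf P z) {q : Cube} :
    q ∈ P ↔ (q 2 : ℤ) < z (proj q) := by
  rw [← h, solid_proj]

theorem IsHeightOf.mono {P P' : Set Cube} {z z' : ℤ × ℤ → ℤ} (h : IsHeightOf P z)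
    (h' : IsHeightOf P' z') (hP : P ⊆ P') : z ≤ z' := by
  intro v
  have : z v - 1 < z' v := (h' v (z v - 1)).1 fun q hq h2 => hP ((h v (z v - 1)).2 (by omega) q hq h2)
  exact Int.le_of_sub_one_lt this

theorem Solid.of_add {P : Set Cube} (hP : IsCompactPile P) {v : ℤ × ℤ} {k : Fin 3} {t : ℤ}
    (h : Solid P (v + dir k) (t + lev k)) : Solid P v t := by
  intro q hq h2
  have := h (q + Pi.single k 1) (by rw [proj_add_single, hq]) (by rw [add_single_two, h2])
  exact isCompactPile_iff_isLowerSet.1 hP (by simp) this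

/-- A step along the diagonal `(1,1,1)` is one step in each axis direction; compactness allows
undoing all three. -/
theorem Solid.of_add_one {P : Set Cube} (hP : IsCompactPile P) {v : ℤ × ℤ} {t : ℤ}
    (h : Solid P v (t + 1)) : Solid P v t := by
  refine Solid.of_add hP (k := 0) (Solid.of_add hP (k := 1) (Solid.of_add hP (k := 2) ?_))
  simpa [dir_cycle, lev] using h

theorem Solid.of_le {P : Set Cube} (hP : IsCompactPile P) {v : ℤ × ℤ} {s t : ℤ} (hst : s ≤ t)
    (h : Solid P v t) : Solid P v s := by
  induction s, hst using Int.leInductionDown with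
  | base => exact h
  | pred n hn ih => exact Solid.of_add_one hP (by simpa using ih)

theorem exists_isHeightOf {P : Set Cube} (hf : P.Finite) (hP : IsCompactPile P) :
    ∃ z, IsHeightOf P z := by
  have key : ∀ v, ∃ t, Solid P v t ∧ ∀ s, Solid P v s → s ≤ t := by
    intro v
    refine Int.exists_greatest_of_bdd ?_ ⟨-1, fun q _ h => by omega⟩
    obtain ⟨N, hN⟩ := (hf.image fun p : Cube => (p 2 : ℤ)).bddAbove
    -- Above this bound the point over `v` lies in the octant and higher than every cube of `P`, so
    -- it is not solid.
    refine ⟨max N (max 0 (max (-v.1) (-v.2))), fun t ht => ?_⟩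
    by_contra! hlt
    have := hN (Set.mem_image_of_mem (fun p : Cube => (p 2 : ℤ))
      (ht ![(v.1 + t).toNat, (v.2 + t).toNat, t.toNat] (by ext <;> simp [proj] <;> omega)
        (by simp; omega)))
    simp at this hlt
    omega
  choose z hz hz' using key
  refine ⟨fun v => z v + 1, fun v t => ⟨fun h => Int.lt_add_one_of_le (hz' v t h), fun h => ?_⟩⟩
  exact Solid.of_le hP (Int.le_of_lt_add_one h) (hz v)

/-! ### Surfaces of piles as tilings of the plane -/

/-- The squares of the walls of the octant on which no cube of `P` stands. -/
def outerSquares (P : Set Cube) : Set Square := {s | s.corner s.axis = 0 ∧ s.corner ∉ P}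

/-- The surface of a pile put on the three walls of the octant. -/
def fullSurface (P : Set Cube) : Set Square := visibleFaces P ∪ outerSquares P

/-- A surface square separates a solid point from its non-solid successor in direction `k`; for a
wall square the solid point lies outside the octant, where solidity is vacuous. -/
theorem mem_planeTiling_iff {P : Set Cube} {k : Fin 3} {v : ℤ × ℤ} :
    (⟨k, v + dir k⟩ : Lozenge) ∈ Square.toLozenge '' fullSurface P ↔
      ∃ t, ¬ Solid P (v + dir k) (t + lev k) ∧ Solid P v t := by
  constructor
  · rintro ⟨⟨j, c⟩, hs, he⟩
    simp only [Square.toLozenge, Lozenge.mk.injEq] at he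
    obtain ⟨rfl, he⟩ := he
    refine ⟨c 2 - lev j, ?_, fun r hr h2 => ?_⟩
    · rw [sub_add_cancel, ← he, solid_proj]
      rcases hs with ⟨p, hp, hc, hn⟩ | ⟨-, hn⟩ <;> exact hn
    · have hrc : r + Pi.single j 1 = c := cube_ext (by rw [proj_add_single, he, hr])
        (by have := add_single_two r j; omega)
      rcases hs with ⟨p, hp, hc, hn⟩ | ⟨h0, hn⟩
      · simp only at hc
        rw [← hrc] at hc
        rwa [add_right_cancel hc]
      · simp [← hrc] at h0
  · rintro ⟨t, h1, h2⟩
    simp only [Solid, not_forall] at h1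
    obtain ⟨q, hq, hq2, hqP⟩ := h1
    refine ⟨⟨k, q⟩, ?_, by simp [Square.toLozenge, hq]⟩
    rcases Nat.eq_zero_or_pos (q k) with h0 | h0
    · exact Or.inr ⟨h0, hqP⟩
    · have e : q - Pi.single k 1 + Pi.single k 1 = q := by
        refine tsub_add_cancel_of_le fun i => ?_
        by_cases hi : i = k
        · subst hi; simpa using Nat.succ_le_of_lt h0
        · simp [hi]
      have e1 := proj_add_single (q - Pi.single k 1) k
      have e2 := add_single_two (q - Pi.single k 1) k
      rw [e] at e1 e2
      exact Or.inl ⟨q - Pi.single k 1, h2 _ (add_right_cancel (e1.symm.trans hq)) (by omega),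
        e.symm, hqP⟩

/-- Compactness bounds the increment along each edge by `lev k`. Going round a triangle, the bounds
on the other two edges give at least `lev k - 1`, and the drop by one occurs exactly at surface
squares. -/
theorem IsHeightOf.isHeight {P : Set Cube} {z : ℤ × ℤ → ℤ} (hP : IsCompactPile P)
    (h : IsHeightOf P z) : IsHeight z (Square.toLozenge '' fullSurface P) := by
  have hle : ∀ v k, z (v + dir k) ≤ z v + lev k := fun v k => by
    have h1 := (h (v + dir k) (z (v + dir k) - 1)).2 (by omega)
    have h2 := (h v _).1 (Solid.of_add hP (k := k) (t := z (v + dir k) - 1 - lev k) (by simpa))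
    omega
  intro v k
  have hge : z v + lev k - 1 ≤ z (v + dir k) := by
    fin_cases k
    · have h1 := hle (v + dir 0) 1
      have h2 := hle (v + dir 0 + dir 1) 2
      simp [dir_cycle, lev] at *; omega
    · have h1 := hle (v + dir 1) 0
      have h2 := hle (v + dir 1 + dir 0) 2
      simp [dir_cycle', lev] at *; omega
    · have h1 := hle (v + dir 2) 0
      have h2 := hle (v + dir 2 + dir 0) 1
      have e : v + dir 2 + dir 0 + dir 1 = v := by ext <;> simp [dir]
      simp [e, lev] at *; omega
  have hm := mem_planeTiling_iff (P := P) (k := k) (v := v)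
  simp only [h _ _] at hm
  have hk := hle v k
  by_cases hmem : (⟨k, v + dir k⟩ : Lozenge) ∈ Square.toLozenge '' fullSurface P
  · rw [incr_of_mem hmem]
    obtain ⟨t, h1, h2⟩ := hm.1 hmem
    omega
  · have : z v + lev k ≤ z (v + dir k) := by
      by_contra h'
      exact hmem (hm.2 ⟨z v - 1, by omega, by omega⟩)
    have h1 : incr (Square.toLozenge '' fullSurface P) k v = lev k := by simp [incr, hmem]
    omega

theorem injOn_toLozenge {P : Set Cube} (hf : P.Finite) (hP : IsCompactPile P) :
    Set.InjOn Square.toLozenge (fullSurface P) := by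
  obtain ⟨z, hz⟩ := exists_isHeightOf hf hP
  -- The corner of a surface square is the first non-solid point on its diagonal, hence is recovered
  -- from its projection.
  have key : ∀ s ∈ fullSurface P, (s.corner 2 : ℤ) = z (proj s.corner) := by
    rintro ⟨k, c⟩ hs
    have hn : c ∉ P := by rcases hs with ⟨p, hp, hc, hn⟩ | ⟨-, hn⟩ <;> exact hn
    rw [hz.mem_iff] at hn
    have hs2 : Solid P (proj c - dir k) (c 2 - lev k) := by
      intro r hr h2
      have hrc : r + Pi.single k 1 = c := cube_ext (by rw [proj_add_single, hr, sub_add_cancel])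
        (by have := add_single_two r k; omega)
      rcases hs with ⟨p, hp, hc, hn⟩ | ⟨h0, hn⟩
      · simp only at hc
        rw [← hrc] at hc
        rwa [add_right_cancel hc]
      · simp [← hrc] at h0
    have h3 := hz.isHeight hP (proj c - dir k) k
    rw [sub_add_cancel] at h3
    have h4 := le_incr (Square.toLozenge '' fullSurface P) k (proj c - dir k)
    have h5 := (hz _ _).1 hs2
    simp only
    omega
  rintro s hs s' hs' h
  have h1 := key s hs
  have h2 := key s' hs'
  simp only [Square.toLozenge, Lozenge.mk.injEq] at h
  rw [h.2] at h1
  exact Square.ext h.1 (cube_ext h.2 (by omega))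

theorem isTiling_fullSurface {P : Set Cube} (hf : P.Finite) (hP : IsCompactPile P) :
    IsTiling Set.univ (Square.toLozenge '' fullSurface P) := by
  obtain ⟨z, hz⟩ := exists_isHeightOf hf hP
  exact (hz.isHeight hP).isTiling

theorem isCompactPile_empty : IsCompactPile ∅ := fun _ h => h.elim

/-- Every tiling of the plane with a height function that is at least the height `z₀` of the walls
is the surface of a pile. -/
theorem exists_pile_of_isHeight {T : Set Lozenge} {z z₀ : ℤ × ℤ → ℤ} (h : IsHeight z T)
    (h₀ : IsHeightOf ∅ z₀) (hle : z₀ ≤ z) :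
    IsCompactPile {p | (p 2 : ℤ) < z (proj p)} ∧ IsHeightOf {p | (p 2 : ℤ) < z (proj p)} z := by
  constructor
  · rw [isCompactPile_iff_isLowerSet]
    have hstep : ∀ (p : Cube) k, ((p + Pi.single k 1 : Cube) 2 : ℤ) < z (proj (p + Pi.single k 1)) →
        (p 2 : ℤ) < z (proj p) := by
      intro p k hp
      rw [add_single_two, proj_add_single] at hp
      have := h.le_step (proj p) k
      omega
    have hn : ∀ (n : ℕ) (p : Cube) k, ((p + n • Pi.single k 1 : Cube) 2 : ℤ) <
        z (proj (p + n • Pi.single k 1)) → (p 2 : ℤ) < z (proj p) := by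
      intro n
      induction n with
      | zero => intro p k; simp
      | succ n ih =>
        intro p k hp
        rw [succ_nsmul, ← add_assoc] at hp
        exact ih _ _ (hstep _ _ hp)
    intro p q hqp hp
    have e : p = q + (p 0 - q 0) • Pi.single 0 1 + (p 1 - q 1) • Pi.single 1 1 +
        (p 2 - q 2) • Pi.single 2 1 := by
      have h0 : q 0 ≤ p 0 := hqp 0
      have h1 : q 1 ≤ p 1 := hqp 1
      have h2 : q 2 ≤ p 2 := hqp 2
      ext k
      fin_cases k <;> simp <;> omega
    rw [Set.mem_ofPred_eq, e] at hp
    exact hn _ _ _ (hn _ _ _ (hn _ _ _ hp))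
  · intro v t
    refine ⟨fun hs => ?_, fun ht q hq h2 => by rw [Set.mem_ofPred_eq, hq, h2]; exact ht⟩
    by_cases hq : ∃ q : Cube, proj q = v ∧ (q 2 : ℤ) = t
    · obtain ⟨q, rfl, rfl⟩ := hq
      exact hs q rfl rfl
    -- Off the octant solidity is vacuous, even for the empty pile, so `t` is below the walls and
    -- hence below `z`.
    · exact ((h₀ v t).1 fun q h1 h2 => (hq ⟨q, h1, h2⟩).elim).trans_le (hle v)

/-! ### The domain of a compact pile -/

theorem region_union (A B : Set Lozenge) : region (A ∪ B) = region A ∪ region B :=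
  Set.biUnion_union A B Lozenge.cells

theorem region_hexagon (v : ℤ × ℤ) : region (Set.range fun k => (⟨k, v + dir k⟩ : Lozenge)) =
    region (Set.range fun k => (⟨k, v⟩ : Lozenge)) := by
  obtain ⟨x, y⟩ := v
  ext (⟨s, t⟩ | ⟨s, t⟩) <;>
    simp [region, Fin.exists_fin_succ, Lozenge.cells, dir] <;> omega

theorem DownFlip.region_eq {T T' : Set Lozenge} (h : DownFlip T T') : region T' = region T := by
  obtain ⟨v, hv, rfl⟩ := h
  rw [region_union, ← region_hexagon, ← region_union, Set.sdiff_union_of_subset]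
  rintro _ ⟨k, rfl⟩
  exact hv k

theorem isTiling_union {D E : Set Triangle} {A B : Set Lozenge} (hA : IsTiling D A)
    (hB : IsTiling E B) (hDE : Disjoint D E) : IsTiling (D ∪ E) (A ∪ B) := by
  obtain ⟨hA, rfl⟩ := hA
  obtain ⟨hB, rfl⟩ := hB
  refine ⟨(Set.pairwiseDisjoint_union).2 ⟨hA, hB, fun a ha b hb _ => ?_⟩, region_union A B⟩
  exact hDE.mono (Set.subset_biUnion_of_mem (u := Lozenge.cells) ha)
    (Set.subset_biUnion_of_mem (u := Lozenge.cells) hb)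

theorem isTiling_compl {A B : Set Lozenge} (h : IsTiling Set.univ (A ∪ B)) (hd : Disjoint A B) :
    IsTiling (region B)ᶜ A := by
  refine ⟨h.1.subset Set.subset_union_left, ?_⟩
  refine (IsCompl.compl_eq ⟨?_, ?_⟩).symm
  · refine Set.disjoint_left.2 fun t htB htA => ?_
    obtain ⟨b, hb, htb⟩ := Set.mem_iUnion₂.1 htB
    obtain ⟨a, ha, hta⟩ := Set.mem_iUnion₂.1 htA
    have := h.1.elim_set (Or.inl ha) (Or.inr hb) t hta htb
    exact Set.disjoint_left.1 hd ha (this ▸ hb)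
  · rw [codisjoint_iff, sup_comm]
    exact (region_union A B).symm.trans h.2

theorem IsTiling.disjoint {D E : Set Triangle} {A B : Set Lozenge} (hA : IsTiling D A)
    (hB : IsTiling E B) (hDE : Disjoint D E) : Disjoint A B := by
  refine Set.disjoint_left.2 fun l ha hb => ?_
  obtain ⟨t, ht⟩ := l.cells_nonempty
  exact Set.disjoint_left.1 hDE ((isTiling_iff.1 hA).1 l ha ht) ((isTiling_iff.1 hB).1 l hb ht)

/-- The part of the plane covered by a compact pile seen from the direction `(1,1,1)`. -/
def domain (Q : Set Cube) : Set Triangle := region (Square.toLozenge '' visibleFaces Q)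

theorem IsPseudoHexagonOf.eq_domain {Q : Set Cube} {D : Set Triangle}
    (h : IsPseudoHexagonOf Q D) : D = domain Q := by
  obtain ⟨-, -, T₀, hT, -, rfl⟩ := h
  induction hT with
  | refl => rfl
  | tail _ h ih => rw [h.region_eq, ih]

theorem disjoint_visibleFaces_outerSquares (P Q : Set Cube) :
    Disjoint (visibleFaces P) (outerSquares Q) := by
  refine Set.disjoint_left.2 ?_
  rintro ⟨k, c⟩ ⟨p, -, hc, -⟩ ⟨h0, -⟩
  simp only at hc h0
  simp [hc] at h0

/-- The greatest compact pile of cubes that project into `domain Q`. -/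
def maxPile (Q : Set Cube) : Set Cube := {p | ∀ k, Function.update p k 0 ∈ Q}

theorem subset_maxPile {Q : Set Cube} (hQ : IsCompactPile Q) : Q ⊆ maxPile Q :=
  fun p hp k => hQ p hp k 0 (Nat.zero_le _)

theorem maxPile_compact {Q : Set Cube} (hQ : IsCompactPile Q) : IsCompactPile (maxPile Q) := by
  rw [isCompactPile_iff_isLowerSet] at *
  intro p q hqp hp k
  exact hQ (update_le_update_iff.2 ⟨le_rfl, fun j _ => hqp j⟩) (hp k)

theorem maxPile_finite {Q : Set Cube} (hf : Q.Finite) : (maxPile Q).Finite := by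
  obtain ⟨N, hN⟩ := hf.bddAbove
  refine (Set.finite_Iic N).subset fun p hp k => ?_
  have := hN (hp (k + 1)) k
  rwa [Function.update_of_ne (by fin_cases k <;> decide)] at this

theorem outerSquares_subset {P Q : Set Cube} (h : P ⊆ maxPile Q) :
    outerSquares Q ⊆ outerSquares P := by
  rintro ⟨k, c⟩ ⟨h0, hn⟩
  refine ⟨h0, fun hc => hn ?_⟩
  have := h hc k
  simp only at h0
  rwa [← h0, Function.update_eq_self] at this

/-- The full surface of `Q` tiles the plane and splits into the visible faces, which cover the
domain, and the outer wall squares. -/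
theorem domain_eq_compl {Q : Set Cube} (hf : Q.Finite) (hQ : IsCompactPile Q) :
    domain Q = (region (Square.toLozenge '' outerSquares Q))ᶜ := by
  have h := isTiling_fullSurface hf hQ
  rw [fullSurface, Set.image_union] at h
  exact (isTiling_compl h ((disjoint_visibleFaces_outerSquares Q Q).image (injOn_toLozenge hf hQ)
    Set.subset_union_left Set.subset_union_right)).2

theorem isTiling_outerSquares {Q : Set Cube} (hf : Q.Finite) (hQ : IsCompactPile Q) :
    IsTiling (domain Q)ᶜ (Square.toLozenge '' outerSquares Q) := by
  rw [domain_eq_compl hf hQ, compl_compl]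
  exact ⟨(isTiling_fullSurface hf hQ).1.subset (Set.image_mono Set.subset_union_right), rfl⟩

theorem baseSquares_domain {Q : Set Cube} (hf : Q.Finite) (hQ : IsCompactPile Q) :
    baseSquares (domain Q) = {s | s.corner s.axis = 0 ∧ s.corner ∈ Q} := by
  have hO := isTiling_iff.1 (isTiling_outerSquares hf hQ)
  ext s
  refine and_congr_right fun h0 => ⟨fun hs => ?_, fun hs => ?_⟩
  · by_contra hn
    obtain ⟨t, ht⟩ := s.toLozenge.cells_nonempty
    exact hO.1 _ (Set.mem_image_of_mem _ ⟨h0, hn⟩) ht (hs ht)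
  · intro t ht
    by_contra htD
    obtain ⟨_, ⟨⟨o, ho, rfl⟩, hto⟩, -⟩ := hO.2 t htD
    -- The bare walls also tile the plane, so a wall square under `Q` cannot overlap an outer one.
    have hE := isTiling_fullSurface Set.finite_empty isCompactPile_empty
    have hs0 : s ∈ fullSurface ∅ := Or.inr ⟨h0, id⟩
    have ho0 : o ∈ fullSurface ∅ := Or.inr ⟨ho.1, id⟩
    have e := hE.1.elim_set (Set.mem_image_of_mem _ hs0) (Set.mem_image_of_mem _ ho0) t ht hto
    have := injOn_toLozenge Set.finite_empty isCompactPile_empty hs0 ho0 e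
    exact ho.2 (this ▸ hs)

theorem surface_eq_sdiff {P Q : Set Cube} (hf : Q.Finite) (hQ : IsCompactPile Q) :
    surface (domain Q) P = fullSurface P \ outerSquares Q := by
  ext s
  have hd : s ∈ visibleFaces P → s ∉ outerSquares Q := fun h h' =>
    Set.disjoint_left.1 (disjoint_visibleFaces_outerSquares P Q) h h'
  rw [surface, baseSquares_domain hf hQ, fullSurface]
  simp only [outerSquares, Set.mem_union, Set.mem_sdiff, Set.mem_ofPred_eq] at hd ⊢
  tauto

theorem surface_union_outerSquares {P Q : Set Cube} (hf : Q.Finite) (hQ : IsCompactPile Q)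
    (hPQ : P ⊆ maxPile Q) : surface (domain Q) P ∪ outerSquares Q = fullSurface P := by
  rw [surface_eq_sdiff hf hQ, Set.sdiff_union_of_subset]
  exact (outerSquares_subset hPQ).trans Set.subset_union_right

theorem surface_subset_fullSurface {P Q : Set Cube} (hf : Q.Finite) (hQ : IsCompactPile Q) :
    surface (domain Q) P ⊆ fullSurface P := by
  rw [surface_eq_sdiff hf hQ]
  exact Set.sdiff_subset

theorem injOn_surface {P Q : Set Cube} (hf : Q.Finite) (hQ : IsCompactPile Q)
    (hP : IsCompactPile P) (hPQ : P ⊆ maxPile Q) :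
    Set.InjOn Square.toLozenge (surface (domain Q) P) :=
  (injOn_toLozenge ((maxPile_finite hf).subset hPQ) hP).mono (surface_subset_fullSurface hf hQ)

/-- The full surfaces of `P` and `Q` contain the same outer squares of `Q`; removing these from the
plane tiling of `P` leaves a tiling of the domain. -/
theorem isTiling_surface {P Q : Set Cube} (hf : Q.Finite) (hQ : IsCompactPile Q)
    (hP : IsCompactPile P) (hPQ : P ⊆ maxPile Q) :
    IsTiling (domain Q) (Square.toLozenge '' surface (domain Q) P) := by
  have hPf := (maxPile_finite hf).subset hPQ
  have h := isTiling_fullSurface hPf hP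
  have hu := surface_union_outerSquares hf hQ hPQ
  rw [← hu, Set.image_union] at h
  rw [domain_eq_compl hf hQ] at *
  refine isTiling_compl h (Disjoint.image ?_ (injOn_toLozenge hPf hP) (hu ▸ Set.subset_union_left)
    (hu ▸ Set.subset_union_right))
  rw [← domain_eq_compl hf hQ, surface_eq_sdiff hf hQ]
  exact Set.disjoint_sdiff_left

theorem correspondsTo_surface {P Q : Set Cube} (hf : Q.Finite) (hQ : IsCompactPile Q)
    (hP : IsCompactPile P) (hPQ : P ⊆ maxPile Q) :
    CorrespondsTo (domain Q) P (Square.toLozenge '' surface (domain Q) P) :=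
  (injOn_surface hf hQ hP hPQ).bijOn_image

theorem hexagon_subset_domain {Q : Set Cube} (hf : Q.Finite) (hQ : IsCompactPile Q) {p : Cube}
    (hp : p ∈ maxPile Q) : hexagon p ⊆ domain Q := by
  -- In the box below `p` the three upper faces of `p` are visible, and they cover the same hexagon
  -- as the lower faces.
  have hc : IsCompactPile (Set.Iic p) := isCompactPile_iff_isLowerSet.2 (isLowerSet_Iic p)
  have hs : Set.Iic p ⊆ maxPile Q :=
    fun q hq => isCompactPile_iff_isLowerSet.1 (maxPile_compact hQ) hq hp
  have h := (isTiling_surface hf hQ hc hs).2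
  have e : hexagon p = region (Set.range fun k => (⟨k, proj p⟩ : Lozenge)) := rfl
  rw [e, ← region_hexagon, ← h]
  refine Set.biUnion_subset_biUnion_left ?_
  rintro _ ⟨k, rfl⟩
  refine ⟨⟨k, p + Pi.single k 1⟩, Or.inl ⟨p, Set.mem_Iic.2 le_rfl, rfl, fun h => ?_⟩, ?_⟩
  · have := h k
    simp at this
  · simp [Square.toLozenge, proj_add_single]

theorem isPileIn_domain_iff {P Q : Set Cube} (hf : Q.Finite) (hQ : IsCompactPile Q)
    (hP : IsCompactPile P) : IsPileIn (domain Q) P ↔ P ⊆ maxPile Q := by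
  refine ⟨fun h p hp k => ?_, fun h =>
    ⟨(maxPile_finite hf).subset h, fun p hp => hexagon_subset_domain hf hQ (h hp)⟩⟩
  have hs : (⟨k, Function.update p k 0⟩ : Square) ∈ baseSquares (domain Q) :=
    ⟨by simp, (Set.subset_biUnion_of_mem (u := Lozenge.cells) (Set.mem_range_self k)).trans
      (h.2 _ (hP p hp k 0 (Nat.zero_le _)))⟩
  rw [baseSquares_domain hf hQ] at hs
  exact hs.2

/-! ### Recovering the pile from a tiling -/

theorem exists_single_notMem {P : Set Cube} (hf : P.Finite) : ∃ N, ∀ k, Pi.single k N ∉ P := by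
  obtain ⟨M, hM⟩ := hf.bddAbove
  refine ⟨M 0 + M 1 + M 2 + 1, fun k hk => ?_⟩
  have := hM hk k
  fin_cases k <;> simp at this <;> omega

/-- The point just before `q` on its diagonal has `j`-th coordinate `-1`, so it is solid, and `q` is
the first non-solid one. -/
theorem IsHeightOf.eq_of_notMem {P : Set Cube} {z : ℤ × ℤ → ℤ} (h : IsHeightOf P z) {q : Cube}
    {j : Fin 3} (hq : q ∉ P) (hj : q j = 0) : z (proj q) = q 2 := by
  rw [h.mem_iff] at hq
  have : (q 2 : ℤ) - 1 < z (proj q) := (h _ _).1 fun r hr h2 => by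
    simp only [proj, Prod.mk.injEq] at hr
    fin_cases j <;> simp at hj <;> omega
  omega

/-- Both piles give the same plane tiling, so their heights differ by a constant; a point far out on
an axis shows that the constant is zero. -/
theorem eq_of_image_surface_eq {P P' Q : Set Cube} (hf : Q.Finite) (hQ : IsCompactPile Q)
    (hP : IsCompactPile P) (hPQ : P ⊆ maxPile Q) (hP' : IsCompactPile P') (hPQ' : P' ⊆ maxPile Q)
    (h : Square.toLozenge '' surface (domain Q) P = Square.toLozenge '' surface (domain Q) P') :
    P = P' := by
  obtain ⟨z, hz⟩ := exists_isHeightOf ((maxPile_finite hf).subset hPQ) hP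
  obtain ⟨z', hz'⟩ := exists_isHeightOf ((maxPile_finite hf).subset hPQ') hP'
  obtain ⟨N, hN⟩ := exists_single_notMem (maxPile_finite hf)
  have h1 := hz.isHeight hP
  have h2 := hz'.isHeight hP'
  rw [← surface_union_outerSquares hf hQ hPQ, Set.image_union, h, ← Set.image_union,
    surface_union_outerSquares hf hQ hPQ'] at h1
  have e := h1.eq_of_eq h2 (proj (Pi.single 0 N)) (by
    rw [hz.eq_of_notMem (j := 1) (fun h => hN 0 (hPQ h)) (by simp),
      hz'.eq_of_notMem (j := 1) (fun h => hN 0 (hPQ' h)) (by simp)])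
  ext p
  rw [hz.mem_iff, hz'.mem_iff, e]

theorem exists_cube_on_wall (v : ℤ × ℤ) : ∃ (q : Cube) (j : Fin 3), q j = 0 ∧ proj q = v := by
  obtain ⟨x, y⟩ := v
  have h : ∀ t, 0 ≤ t → 0 ≤ x + t → 0 ≤ y + t →
      proj ![(x + t).toNat, (y + t).toNat, t.toNat] = (x, y) := fun t h0 h1 h2 => by
    ext <;> simp [proj] <;> omega
  rcases le_total 0 x with hx | hx <;> rcases le_total 0 y with hy | hy
  · exact ⟨_, 2, by simp, h 0 (by omega) (by omega) (by omega)⟩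
  · exact ⟨_, 1, by simp, h (-y) (by omega) (by omega) (by omega)⟩
  · exact ⟨_, 0, by simp, h (-x) (by omega) (by omega) (by omega)⟩
  · rcases le_total x y with hxy | hxy
    · exact ⟨_, 0, by simp, h (-x) (by omega) (by omega) (by omega)⟩
    · exact ⟨_, 1, by simp, h (-y) (by omega) (by omega) (by omega)⟩

theorem add_single_add_one (q : Cube) (k : Fin 3) (n : ℕ) :
    q + Pi.single k (n + 1) = q + Pi.single k n + Pi.single k 1 := by
  rw [Pi.single_add, add_assoc]

/-- A height function of a tiling that contains the squares of the walls outside of `Q` is known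
outside of `Q`, and bounded from below by the height of the walls. -/
theorem exists_isHeight_normalized {Q : Set Cube} (hf : Q.Finite) (hQ : IsCompactPile Q)
    {T : Set Lozenge} (hT : IsTiling Set.univ T)
    (hO : Square.toLozenge '' outerSquares Q ⊆ T) :
    ∃ z, IsHeight z T ∧ (∀ (q : Cube) j, q j = 0 → q ∉ Q → z (proj q) = q 2) ∧
      ∀ (q : Cube) j, q j = 0 → (q 2 : ℤ) ≤ z (proj q) := by
  have hQ' := isCompactPile_iff_isLowerSet.1 hQ
  obtain ⟨N, hN⟩ := exists_single_notMem hf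
  obtain ⟨z, hz, hz0⟩ : ∃ z, IsHeight z T ∧
      z (proj (Pi.single 0 N)) = ((Pi.single 0 N : Cube) 2 : ℤ) := by
    obtain ⟨z, hz⟩ := exists_isHeight hT
    exact ⟨_, hz.sub_const (z (proj (Pi.single 0 N)) - ((Pi.single 0 N : Cube) 2 : ℤ)), by simp⟩
  -- On a wall outside of `Q` the lozenges of `T` are wall squares, so moving along the wall
  -- preserves agreement with its height.
  have step : ∀ (q : Cube) j k n, q j = 0 → k ≠ j → q ∉ Q →
      (z (proj q) = q 2 ↔ z (proj (q + Pi.single k n)) = ((q + Pi.single k n : Cube) 2 : ℤ)) := by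
    intro q j k n hj hk hq
    induction n with
    | zero => simp
    | succ n ih =>
      have hm : (⟨j, proj (q + Pi.single k n)⟩ : Lozenge) ∈ T :=
        hO ⟨⟨j, q + Pi.single k n⟩, ⟨by simp [hj, hk.symm], fun h => hq (hQ' (by simp) h)⟩, rfl⟩
      rw [ih, add_single_add_one, proj_add_single, add_single_two, hz.step hm hk]
      omega
  have hax : ∀ k, z (proj (Pi.single k N)) = ((Pi.single k N : Cube) 2 : ℤ) := by
    intro k
    by_cases hk : k = 0
    · rw [hk, hz0]
    · obtain ⟨j, hj0, hjk⟩ : ∃ j : Fin 3, j ≠ 0 ∧ j ≠ k := by clear * -; decide +revert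
      -- Axes `0` and `k` span the wall `j`; their far points are connected through `N • (e₀ + eₖ)`,
      -- avoiding `Q`.
      rw [step _ j 0 N (by simp [hjk]) hj0.symm (hN k), add_comm,
        ← step _ j k N (by simp [hj0]) hjk.symm (hN 0), hz0]
  have hout : ∀ (q : Cube) j, q j = 0 → q ∉ Q → z (proj q) = q 2 := by
    intro q j hj hq
    obtain ⟨k, l, hkj, hlj, hkl⟩ : ∃ k l : Fin 3, k ≠ j ∧ l ≠ j ∧ k ≠ l := by clear * -; decide +revert
    have e : q + Pi.single k N = Pi.single k N + Pi.single k (q k) + Pi.single l (q l) := by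
      ext i
      have : i = j ∨ i = k ∨ i = l := by omega
      rcases this with rfl | rfl | rfl
      · simp [hj, hkj.symm, hlj.symm]
      · simp [hkl, add_comm]
      · simp [hkl.symm]
    rw [step q j k N hj hkj hq, e,
      ← step _ j l _ (by simp [hkj.symm]) hlj (fun h => hN k (hQ' (by simp) h)),
      ← step _ j k _ (by simp [hkj.symm]) hkj (hN k)]
    exact hax k
  refine ⟨z, hz, hout, fun q j hj => ?_⟩
  -- The excess of `z` over the third coordinate cannot grow along positive steps, and it is zero
  -- once the walk on the wall has left `Q`.
  have hle : ∀ k n, z (proj (q + Pi.single k n)) - ((q + Pi.single k n : Cube) 2 : ℤ) ≤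
      z (proj q) - q 2 := by
    intro k n
    induction n with
    | zero => simp
    | succ n ih =>
      have := hz.le_step (proj (q + Pi.single k n)) k
      rw [add_single_add_one, proj_add_single, add_single_two]
      omega
  obtain ⟨k, hk⟩ : ∃ k : Fin 3, k ≠ j := by clear * -; decide +revert
  have h1 := hle k N
  rw [hout _ j (by simp [hj, hk.symm]) fun h => hN k (hQ' (by simp) h)] at h1
  omega

theorem exists_pile_of_isTiling {Q : Set Cube} (hf : Q.Finite) (hQ : IsCompactPile Q)
    {T : Set Lozenge} (hT : IsTiling (domain Q) T) :
    ∃ P, IsCompactPile P ∧ P ⊆ maxPile Q ∧ Square.toLozenge '' surface (domain Q) P = T := by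
  have hO := isTiling_outerSquares hf hQ
  have hTO := isTiling_union hT hO disjoint_compl_right
  rw [Set.union_compl_self] at hTO
  obtain ⟨z, hz, hout, hle⟩ := exists_isHeight_normalized hf hQ hTO Set.subset_union_right
  obtain ⟨z₀, h₀⟩ := exists_isHeightOf Set.finite_empty isCompactPile_empty
  obtain ⟨hP, hPz⟩ := exists_pile_of_isHeight hz h₀ (by
    intro v
    obtain ⟨q, j, hj, rfl⟩ := exists_cube_on_wall v
    rw [h₀.eq_of_notMem (Set.notMem_empty q) hj]
    exact hle q j hj)
  have hPQ : {p : Cube | (p 2 : ℤ) < z (proj p)} ⊆ maxPile Q := by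
    intro p hp k
    by_contra hn
    -- The foot of `p` would be a cube of the pile, yet outside of `Q` the height equals that of the
    -- wall.
    have h1 := hP p hp k 0 (Nat.zero_le _)
    rw [Set.mem_ofPred_eq, hout _ k (by simp) hn] at h1
    exact lt_irrefl _ h1
  refine ⟨_, hP, hPQ, ?_⟩
  have e := hz.set_eq (hPz.isHeight hP)
  rw [← surface_union_outerSquares hf hQ hPQ, Set.image_union] at e
  have d1 := hT.disjoint hO disjoint_compl_right
  have d2 := (isTiling_surface hf hQ hP hPQ).disjoint hO disjoint_compl_right
  rw [← Set.union_sdiff_cancel_right d1.le_bot, e, Set.union_sdiff_cancel_right d2.le_bot]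

/-! ### Piles that correspond to tilings are compact -/

theorem exists_visibleFace {P : Set Cube} {p : Cube} (hp : p ∈ P) {k : Fin 3} {m : ℕ}
    (hm : p + Pi.single k m ∉ P) :
    ∃ n, 0 < n ∧ n ≤ m ∧ (⟨k, p + Pi.single k n⟩ : Square) ∈ visibleFaces P := by
  classical
  have hex : ∃ n, p + Pi.single k n ∉ P := ⟨m, hm⟩
  have hpos : Nat.find hex ≠ 0 := fun h => by
    have := Nat.find_spec hex
    rw [h] at this
    simp [hp] at this
  obtain ⟨n, hn⟩ := Nat.exists_eq_succ_of_ne_zero hpos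
  have h1 := Nat.find_min hex (m := n) (by omega)
  refine ⟨_, Nat.pos_of_ne_zero hpos, Nat.find_min' hex hm, p + Pi.single k n, not_not.1 h1, ?_,
    Nat.find_spec hex⟩
  simp only [hn]
  exact add_single_add_one p k n

theorem exists_visibleFace_of_finite {P : Set Cube} (hf : P.Finite) {p : Cube} (hp : p ∈ P)
    (k : Fin 3) : ∃ n, 0 < n ∧ (⟨k, p + Pi.single k n⟩ : Square) ∈ visibleFaces P := by
  obtain ⟨M, hM⟩ := hf.bddAbove
  obtain ⟨n, hn, -, h⟩ := exists_visibleFace hp (k := k) (m := M k + 1) fun h => by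
    have : p k + (M k + 1) ≤ M k := by simpa using hM h k
    omega
  exact ⟨n, hn, h⟩

/-- The foot of the column of cubes in direction `s.axis` through the square `s`. -/
def foot (s : Square) : Cube := Function.update s.corner s.axis 0

/-- Every column over a base square shows an uncovered square, compact or not: the base square
itself, or a top above its lowest cube. -/
theorem subset_foot_image {P Q : Set Cube} (hf : Q.Finite) (hQ : IsCompactPile Q) (hP : P.Finite)
    (k : Fin 3) : {c ∈ Q | c k = 0} ⊆ foot '' {s ∈ surface (domain Q) P | s.axis = k} := by
  rintro c ⟨hcQ, hc0⟩
  by_cases hc : c ∈ P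
  · obtain ⟨n, -, hn⟩ := exists_visibleFace_of_finite hP hc k
    refine ⟨_, ⟨Or.inl hn, rfl⟩, ?_⟩
    ext i
    by_cases hi : i = k
    · subst hi; simp [foot, hc0]
    · simp [foot, hi]
  · refine ⟨⟨k, c⟩, ⟨Or.inr ⟨?_, hc⟩, rfl⟩, ?_⟩
    · rw [baseSquares_domain hf hQ]
      exact ⟨hc0, hcQ⟩
    · simp [foot, ← hc0]

theorem foot_image_eq {P Q : Set Cube} (hf : Q.Finite) (hQ : IsCompactPile Q)
    (hPQ : P ⊆ maxPile Q) (k : Fin 3) :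
    foot '' {s ∈ surface (domain Q) P | s.axis = k} = {c ∈ Q | c k = 0} := by
  refine Set.Subset.antisymm ?_ (subset_foot_image hf hQ ((maxPile_finite hf).subset hPQ) k)
  rintro _ ⟨⟨j, c⟩, ⟨hs, rfl⟩, rfl⟩
  refine ⟨?_, by simp [foot]⟩
  rw [surface, baseSquares_domain hf hQ] at hs
  rcases hs with ⟨p, hp, hc, -⟩ | ⟨⟨h0, hcQ⟩, -⟩
  · convert hPQ hp j using 1
    simp only at hc
    ext i
    by_cases hi : i = j
    · subst hi; simp [foot]
    · simp [foot, hi, hc]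
  · exact hQ c hcQ j 0 (Nat.zero_le _)

/-- A compact pile has no gaps, so a column shows only one uncovered square. -/
theorem injOn_foot {P : Set Cube} (D : Set Triangle) (hP : IsCompactPile P) (k : Fin 3) :
    Set.InjOn foot {s ∈ surface D P | s.axis = k} := by
  have key : ∀ c c' : Cube, (⟨k, c⟩ : Square) ∈ surface D P → (⟨k, c'⟩ : Square) ∈ surface D P →
      Function.update c k 0 = Function.update c' k 0 → c' k ≤ c k := by
    intro c c' hs hs' h
    by_contra! hlt
    have hn : c ∉ P := by rcases hs with ⟨p, hp, hc, hn⟩ | ⟨-, hn⟩ <;> exact hn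
    rcases hs' with ⟨p, hp, hc, -⟩ | ⟨⟨h0, -⟩, -⟩
    · simp only at hc
      refine hn (isCompactPile_iff_isLowerSet.1 hP (fun i => ?_) hp)
      by_cases hi : i = k
      · subst hi; simp [hc] at hlt; omega
      · have := congrFun h i
        simp [hi, hc] at this
        exact this.le
    · simp only at h0
      omega
  rintro ⟨j, c⟩ ⟨hs, hj⟩ ⟨j', c'⟩ ⟨hs', hj'⟩ h
  simp only at hj hj'
  subst hj hj'
  refine Square.ext rfl (funext fun i => ?_)
  by_cases hi : i = j'
  · subst hi
    exact le_antisymm (key c' c hs' hs h.symm) (key c c' hs hs' h)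
  · have := congrFun h i
    simpa [foot, hi] using this

theorem bijOn_axis {D : Set Triangle} {P : Set Cube} {T : Set Lozenge} (h : CorrespondsTo D P T)
    (k : Fin 3) :
    Set.BijOn Square.toLozenge {s ∈ surface D P | s.axis = k} {l ∈ T | l.axis = k} := by
  refine ⟨fun s hs => ⟨h.1 hs.1, hs.2⟩, h.2.1.mono fun _ hs => hs.1, ?_⟩
  rintro l ⟨hl, hk⟩
  obtain ⟨s, hs, rfl⟩ := h.2.2 hl
  exact ⟨s, ⟨hs, hk⟩, rfl⟩

theorem isCompactPile_of_correspondsTo {P Q : Set Cube} (hf : Q.Finite) (hQ : IsCompactPile Q)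
    (hP : P.Finite) {T : Set Lozenge} (hT : IsTiling (domain Q) T)
    (h : CorrespondsTo (domain Q) P T) : IsCompactPile P := by
  obtain ⟨P₁, hP₁, hPQ₁, hT₁⟩ := exists_pile_of_isTiling hf hQ hT
  have h₁ := correspondsTo_surface hf hQ hP₁ hPQ₁
  rw [hT₁] at h₁
  intro p hp k i hi
  have hbf : {c ∈ Q | c k = 0}.Finite := hf.subset fun _ hc => hc.1
  have e₁ := foot_image_eq hf hQ hPQ₁ k
  have i₁ := injOn_foot (domain Q) hP₁ k
  have f₁ := Set.Finite.of_finite_image (by rwa [e₁]) i₁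
  have b₁ := bijOn_axis h₁ k
  have b := bijOn_axis h k
  have hSf : {s ∈ surface (domain Q) P | s.axis = k}.Finite :=
    b.finite_iff_finite.2 (b₁.finite_iff_finite.1 f₁)
  -- The compact pile `P₁` of the same tiling has one square per column, so the count for `P` equals
  -- the number of columns and `foot` is injective for `P` too.
  have hcard : {s ∈ surface (domain Q) P | s.axis = k}.ncard = {c ∈ Q | c k = 0}.ncard := by
    rw [← e₁, i₁.ncard_image, ← b.injOn.ncard_image, b.image_eq,
      ← b₁.injOn.ncard_image, b₁.image_eq]
  have hsub := subset_foot_image hf hQ hP k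
  have hle := Set.ncard_le_ncard hsub (hSf.image _)
  have hle' := Set.ncard_image_le (f := foot) hSf
  have hinj := Set.injOn_of_ncard_image_eq (f := foot) (by omega) hSf
  have himg := Set.eq_of_subset_of_ncard_le hsub (by omega) (hSf.image _)
  by_contra hn
  have hik : i ≠ p k := by rintro rfl; simp [hp] at hn
  obtain ⟨n, hn0, hns⟩ := exists_visibleFace_of_finite hP hp k
  have hs : (⟨k, p + Pi.single k n⟩ : Square) ∈ {s ∈ surface (domain Q) P | s.axis = k} :=
    ⟨Or.inl hns, rfl⟩
  have hfoot : foot ⟨k, p + Pi.single k n⟩ = Function.update p k 0 := by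
    ext j
    by_cases hj : j = k
    · subst hj; simp [foot]
    · simp [foot, hj]
  have hbase : Function.update p k 0 ∈ {c ∈ Q | c k = 0} := by
    rw [himg, ← hfoot]
    exact Set.mem_image_of_mem _ hs
  -- A gap at `i` below `p` gives a second uncovered square in the column of `p`, not above height
  -- `i`, while the first lies above `p`.
  by_cases hc : Function.update p k 0 ∈ P
  · have hn' : Function.update p k 0 + Pi.single k i ∉ P := by
      have e : Function.update p k 0 + Pi.single k i = Function.update p k i := by
        ext j
        by_cases hj : j = k
        · subst hj; simp
        · simp [hj]
      rwa [e]
    obtain ⟨m, -, hmi, hm⟩ := exists_visibleFace hc hn'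
    have := hinj hs (x₂ := ⟨k, _⟩) ⟨Or.inl hm, rfl⟩ (by
      rw [hfoot]
      ext j
      by_cases hj : j = k
      · subst hj; simp [foot]
      · simp [foot, hj])
    simp only [Square.mk.injEq, true_and] at this
    have := congrFun this k
    simp at this
    omega
  · have := hinj hs (x₂ := ⟨k, Function.update p k 0⟩) ⟨Or.inr ⟨by
      rw [baseSquares_domain hf hQ]; exact ⟨hbase.2, hbase.1⟩, hc⟩, rfl⟩ (by
        rw [hfoot]; simp [foot])
    simp only [Square.mk.injEq, true_and] at this
    have := congrFun this k
    simp at this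
    omega

/-! ### Flips -/

/-- Removing `p` uncovers its three lower faces: each is either a base square, since `p` lies in
`maxPile Q`, or the top of the preceding cube. -/
theorem DownFlip.of_maximal {P Q : Set Cube} (hf : Q.Finite) (hQ : IsCompactPile Q)
    (hP : IsCompactPile P) (hPQ : P ⊆ maxPile Q) {p : Cube} (hp : Maximal (· ∈ P) p) :
    DownFlip (Square.toLozenge '' surface (domain Q) P)
      (Square.toLozenge '' surface (domain Q) (P \ {p})) := by
  have hU : (Set.range fun k => (⟨k, p + Pi.single k 1⟩ : Square)) ⊆ surface (domain Q) P := by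
    rintro _ ⟨k, rfl⟩
    refine Or.inl ⟨p, hp.1, rfl, fun h => ?_⟩
    have := hp.2 h (by simp) k
    simp at this
  have hs : surface (domain Q) (P \ {p}) =
      (surface (domain Q) P \ Set.range fun k => (⟨k, p + Pi.single k 1⟩ : Square)) ∪
        Set.range fun k => (⟨k, p⟩ : Square) := by
    ext ⟨k, c⟩
    constructor
    · intro h
      by_cases hc : c = p
      · exact Or.inr ⟨k, by rw [hc]⟩
      · refine Or.inl ⟨?_, ?_⟩
        · rcases h with ⟨q, hq, hqc, hn⟩ | ⟨hb, hn⟩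
          · exact Or.inl ⟨q, hq.1, hqc, fun h => hn ⟨h, hc⟩⟩
          · exact Or.inr ⟨hb, fun h => hn ⟨h, hc⟩⟩
        · rintro ⟨j, hj⟩
          obtain ⟨rfl, rfl⟩ := Square.mk.inj hj
          rcases h with ⟨q, hq, hqc, hn⟩ | ⟨⟨h0, -⟩, hn⟩
          · exact hq.2 (add_right_cancel hqc).symm
          · simp at h0
    · rintro (⟨⟨q, hq, hqc, hn⟩ | ⟨hb, hn⟩, hU⟩ | ⟨j, hj⟩)
      · refine Or.inl ⟨q, ⟨hq, ?_⟩, hqc, fun h => hn h.1⟩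
        rintro rfl
        simp only at hqc
        exact hU ⟨k, by rw [hqc]⟩
      · exact Or.inr ⟨hb, fun h => hn h.1⟩
      · obtain ⟨rfl, rfl⟩ := Square.mk.inj hj
        rcases Nat.eq_zero_or_pos (p j) with h0 | h0
        · refine Or.inr ⟨?_, fun h => h.2 rfl⟩
          rw [baseSquares_domain hf hQ]
          refine ⟨h0, ?_⟩
          have := hPQ hp.1 j
          rwa [← h0, Function.update_eq_self] at this
        · have e : Function.update p j (p j - 1) + Pi.single j 1 = p := by
            ext i
            by_cases hi : i = j
            · subst hi; simp; omega
            · simp [hi]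
          refine Or.inl ⟨Function.update p j (p j - 1), ⟨hP p hp.1 j _ (by omega), fun h => ?_⟩,
            e.symm, fun h => h.2 rfl⟩
          have := congrFun (Set.mem_singleton_iff.1 h) j
          simp at this
          omega
  have e1 : Square.toLozenge '' (Set.range fun k => (⟨k, p + Pi.single k 1⟩ : Square)) =
      Set.range fun k => (⟨k, proj p + dir k⟩ : Lozenge) := by
    rw [← Set.range_comp]
    congr 1
    funext k
    simp [Square.toLozenge, proj_add_single]
  refine ⟨proj p, fun k => ?_, ?_⟩
  · exact (e1 ▸ Set.image_mono hU) ⟨k, rfl⟩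
  · rw [hs, Set.image_union, (injOn_surface hf hQ hP hPQ).image_sdiff_subset hU, e1,
      ← Set.range_comp]
    rfl

theorem reflTransGen_downFlip {P Q : Set Cube} (hf : Q.Finite) (hQ : IsCompactPile Q)
    (hP : IsCompactPile P) (hPQ : P ⊆ maxPile Q) :
    Relation.ReflTransGen DownFlip (Square.toLozenge '' surface (domain Q) P)
      (Square.toLozenge '' surface (domain Q) ∅) := by
  have hPf := (maxPile_finite hf).subset hPQ
  induction hn : P.ncard generalizing P with
  | zero => rw [(Set.ncard_eq_zero hPf).1 hn]
  | succ n ih =>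
    obtain ⟨p, hp⟩ := hPf.exists_maximal (Set.nonempty_of_ncard_ne_zero (by omega))
    refine .head (DownFlip.of_maximal hf hQ hP hPQ hp)
      (ih ?_ (Set.sdiff_subset.trans hPQ) hPf.sdiff ?_)
    · rw [isCompactPile_iff_isLowerSet] at *
      rintro a b hba ⟨ha, hap⟩
      refine ⟨hP hba ha, ?_⟩
      rintro rfl
      exact hap (le_antisymm (hp.2 ha hba) hba)
    · rw [Set.ncard_sdiff_singleton_of_mem hp.1, hn, Nat.add_sub_cancel]

/-- A flip at `v` needs all three edges out of `v` lowered, but `v` lifts to a point of some wall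
`j`, whose square keeps the edges in the other directions unlowered. -/
theorem not_downFlip_surface_empty {Q : Set Cube} (hf : Q.Finite) (hQ : IsCompactPile Q)
    (T : Set Lozenge) : ¬ DownFlip (Square.toLozenge '' surface (domain Q) ∅) T := by
  rintro ⟨v, hv, -⟩
  obtain ⟨q, j, hj, rfl⟩ := exists_cube_on_wall v
  obtain ⟨z, hz⟩ := exists_isHeightOf Set.finite_empty isCompactPile_empty
  have h := hz.isHeight isCompactPile_empty
  obtain ⟨k, hk⟩ : ∃ k : Fin 3, k ≠ j := by clear * -; decide +revert
  have h1 : z (proj q + dir k) = z (proj q) + lev k :=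
    h.step (j := j) ⟨⟨j, q⟩, Or.inr ⟨hj, id⟩, rfl⟩ hk
  have h2 := h (proj q) k
  rw [incr_of_mem (Set.image_mono (surface_subset_fullSurface hf hQ) (hv k))] at h2
  omega

/-! ### Ferrers diagrams and plane partitions -/

theorem IsFerrersDiagram.isLowerSet {S : Set (ℕ × ℕ)} (h : IsFerrersDiagram S) :
    IsLowerSet S := by
  obtain ⟨l, hl, -, rfl⟩ := h
  rintro ⟨c, d⟩ ⟨a, b⟩ ⟨hac, hbd⟩ hd
  simp only [Set.mem_ofPred_eq] at *
  have hc : c < l.length := by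
    by_contra! hc
    rw [List.getD_eq_default _ _ hc] at hd
    exact Nat.not_lt_zero _ hd
  have ha : a < l.length := hac.trans_lt hc
  rw [List.getD_eq_getElem _ _ hc] at hd
  rw [List.getD_eq_getElem _ _ ha]
  have : l[c] ≤ l[a] := by
    rcases hac.eq_or_lt with rfl | h
    · exact le_rfl
    · exact List.pairwise_iff_getElem.1 hl a c ha hc h
  omega

theorem isFerrersDiagram_of_isLowerSet {S : Set (ℕ × ℕ)} (hf : S.Finite) (h : IsLowerSet S) :
    IsFerrersDiagram S := by
  let μ : YoungDiagram := ⟨hf.toFinset, by simpa using h⟩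
  refine ⟨μ.rowLens, μ.rowLens_sorted.pairwise, fun x => μ.pos_of_mem_rowLens x, ?_⟩
  ext ⟨i, j⟩
  have hm : (i, j) ∈ S ↔ (i, j) ∈ μ := by simp [μ, ← YoungDiagram.mem_cells]
  rw [hm, YoungDiagram.mem_iff_lt_rowLen, Set.mem_ofPred_eq]
  by_cases hi : i < μ.rowLens.length
  · rw [List.getD_eq_getElem _ _ hi, YoungDiagram.get_rowLens]
  -- Beyond the last row the default `0` is right, since no column is longer than column `0`.
  · rw [List.getD_eq_default _ _ (not_lt.1 hi), ← YoungDiagram.mem_iff_lt_rowLen,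
      YoungDiagram.mem_iff_lt_colLen]
    rw [YoungDiagram.length_rowLens] at hi
    have := μ.colLen_anti 0 j (Nat.zero_le _)
    omega

theorem isFerrersDiagram_layer {P : Set Cube} (hf : P.Finite) (hP : IsCompactPile P) (k : Fin 3)
    (n : ℕ) : IsFerrersDiagram (layer P k n) := by
  refine isFerrersDiagram_of_isLowerSet
    ((hf.image fun p => (p (k + 1), p (k + 2))).subset ?_) ?_
  · rintro ⟨a, b⟩ ⟨p, hp, -, h1, h2⟩
    exact ⟨p, hp, Prod.ext h1 h2⟩
  · rintro ⟨c, d⟩ ⟨a, b⟩ ⟨hac, hbd⟩ ⟨p, hp, h0, rfl, rfl⟩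
    have e1 : k + 1 ≠ k + 2 := by clear * -; decide +revert
    have e2 : k ≠ k + 1 := by clear * -; decide +revert
    have e3 : k ≠ k + 2 := by clear * -; decide +revert
    exact ⟨Function.update (Function.update p (k + 1) a) (k + 2) b,
      hP _ (hP p hp _ _ hac) _ _ (by simpa [e1.symm] using hbd),
      by simp [e2, e3, h0], by simp [e1], by simp⟩

theorem isCompactPile_of_layer {P : Set Cube}
    (h : ∀ (k : Fin 3) (n : ℕ), IsFerrersDiagram (layer P k n)) : IsCompactPile P := by
  intro p hp k i hi
  have e2 : k + 1 + 2 = k := by clear * -; decide +revert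
  -- Coordinate `k` is lowered inside the layer orthogonal to `k + 1`, where it is the second
  -- coordinate because `k + 1 + 2 = k`.
  obtain ⟨q, hq, h0, h1, h2⟩ := (h (k + 1) (p (k + 1))).isLowerSet
    (a := (p (k + 1 + 1), p (k + 1 + 2))) (b := (p (k + 1 + 1), i))
    ⟨le_rfl, by rw [e2]; exact hi⟩ ⟨p, hp, rfl, rfl, rfl⟩
  convert hq using 1
  ext j
  have hj : j = k ∨ j = k + 1 ∨ j = k + 1 + 1 := by clear * -; decide +revert
  have e1 : k + 1 ≠ k := by clear * -; decide +revert
  have e3 : k + 1 + 1 ≠ k := by clear * -; decide +revert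
  rw [e2] at h2
  rcases hj with rfl | rfl | rfl
  · simpa using h2.symm
  · simpa [e1] using h0.symm
  · simpa [e3] using h1.symm

theorem PlanePartition.entry_anti (A : PlanePartition) {i i' j j' : ℕ} (hi : i ≤ i')
    (hj : j ≤ j') : A.entry i' j' ≤ A.entry i j := by
  by_cases h : (i', j') ∈ A.shape
  · have hl := A.shape_ferrers.isLowerSet
    have h1 : (i, j') ∈ A.shape := hl (show (i, j') ≤ (i', j') from ⟨hi, le_rfl⟩) h
    have h2 : (i, j) ∈ A.shape := hl (show (i, j) ≤ (i, j') from ⟨le_rfl, hj⟩) h1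
    exact (A.col_le _ _ _ h1 h hi).trans (A.row_le _ _ _ h2 h1 hj)
  · simp [A.entry_zero _ _ h]

theorem PlanePartition.isCompactPile_pile (A : PlanePartition) : IsCompactPile A.pile := by
  rw [isCompactPile_iff_isLowerSet]
  intro p q hqp (hp : p 2 < A.entry (p 0) (p 1))
  exact (hqp 2).trans_lt (hp.trans_le (A.entry_anti (hqp 0) (hqp 1)))

theorem PlanePartition.pile_subset_iff {A B : PlanePartition} :
    A.pile ⊆ B.pile ↔ A.BoundedBy B := by
  refine ⟨fun h i j => ?_, fun h p (hp : p 2 < _) => hp.trans_le (h _ _)⟩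
  by_contra! hlt
  -- The witness is the first cube above the column of `B`.
  exact lt_irrefl _ (show B.entry i j < B.entry i j from @h ![i, j, B.entry i j] hlt)

theorem PlanePartition.pile_injective : Function.Injective PlanePartition.pile := by
  intro A B h
  have he : A.entry = B.entry := funext fun i => funext fun j =>
    le_antisymm (pile_subset_iff.1 h.le i j) (pile_subset_iff.1 h.ge i j)
  have hs : ∀ C : PlanePartition, C.shape = {c | 0 < C.entry c.1 c.2} := fun C => by
    ext ⟨i, j⟩
    refine ⟨C.entry_pos i j, fun hc => ?_⟩
    by_contra hn
    exact hc.ne' (C.entry_zero i j hn)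
  have hsh : A.shape = B.shape := by rw [hs, hs, he]
  cases A
  cases B
  simp only at he hsh
  subst he hsh
  rfl

theorem exists_planePartition {P : Set Cube} (hf : P.Finite) (hP : IsCompactPile P) :
    ∃ A : PlanePartition, A.pile = P := by
  classical
  have hP' := isCompactPile_iff_isLowerSet.1 hP
  have key : ∀ i j, ∃ n, ∀ t, ![i, j, t] ∈ P ↔ t < n := by
    intro i j
    obtain ⟨M, hM⟩ := hf.bddAbove
    have hex : ∃ n, (![i, j, n] : Cube) ∉ P := ⟨M 2 + 1, fun h => by
      have : M 2 + 1 ≤ M 2 := hM h 2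
      omega⟩
    refine ⟨Nat.find hex, fun t => ⟨fun h => ?_, fun h => not_not.1 (Nat.find_min hex h)⟩⟩
    by_contra! hle
    refine Nat.find_spec hex (hP' (fun k => ?_) h)
    fin_cases k <;> simp
    simpa using hle
  choose n hn using key
  have anti : ∀ i i' j j', i ≤ i' → j ≤ j' → n i' j' ≤ n i j := by
    intro i i' j j' hi hj
    by_contra! hlt
    refine lt_irrefl _ ((hn i j _).1 (hP' (fun k => ?_) ((hn i' j' _).2 hlt)))
    fin_cases k <;> simp [hi, hj]
  refine ⟨⟨{c | 0 < n c.1 c.2}, ?_, n, fun _ _ h => h, fun _ _ h => Nat.eq_zero_of_not_pos h,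
    fun i j j' _ _ h => anti _ _ _ _ le_rfl h, fun i i' j _ _ h => anti _ _ _ _ h le_rfl⟩, ?_⟩
  -- The shape is the bottom layer of the pile.
  · convert isFerrersDiagram_layer hf hP 2 0 using 1
    ext ⟨i, j⟩
    refine ⟨fun h => ⟨_, (hn i j 0).2 h, rfl, rfl, rfl⟩, ?_⟩
    rintro ⟨p, hp, h2, rfl, rfl⟩
    refine (hn _ _ 0).1 ?_
    convert hp using 1
    ext k
    fin_cases k
    · rfl
    · rfl
    · exact h2.symm
  · ext p
    refine (hn (p 0) (p 1) (p 2)).symm.trans ?_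
    have : ![p 0, p 1, p 2] = p := by
      ext k
      fin_cases k <;> rfl
    rw [this]

theorem surface_maxPile {Q : Set Cube} (hf : Q.Finite) (hQ : IsCompactPile Q) :
    surface (domain Q) (maxPile Q) = visibleFaces (maxPile Q) := by
  rw [surface, baseSquares_domain hf hQ]
  exact Set.union_eq_left.2 fun s hs => (hs.2 (subset_maxPile hQ hs.1.2)).elim

end LozengeTiling

open LozengeTiling

theorem mainTheorem5 (D : Set LozengeTiling.Triangle) (hD : LozengeTiling.IsPseudoHexagon D) :
    -- a pile in the pseudo-hexagon corresponds to a tiling if and only if it is compact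
    (∀ P : Set LozengeTiling.Cube, LozengeTiling.IsPileIn D P →
      ((∃ T, LozengeTiling.IsTiling D T ∧ LozengeTiling.CorrespondsTo D P T) ↔
        LozengeTiling.IsCompactPile P)) ∧
    -- compact means that all sections orthogonal to an axis are Ferrers diagrams
    (∀ P : Set LozengeTiling.Cube, P.Finite →
      (LozengeTiling.IsCompactPile P ↔
        ∀ (k : Fin 3) (n : ℕ), LozengeTiling.IsFerrersDiagram (LozengeTiling.layer P k n))) ∧
    -- the empty pile corresponds to the minimal tiling
    (∃ T₀, LozengeTiling.IsTiling D T₀ ∧ LozengeTiling.CorrespondsTo D ∅ T₀ ∧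
      ∀ T', ¬ LozengeTiling.DownFlip T₀ T') ∧
    -- tilings correspond bijectively to the plane partitions bounded by a given one
    (∃ B : LozengeTiling.PlanePartition,
      LozengeTiling.IsPseudoHexagonOf B.pile D ∧
      IsGreatest {P | LozengeTiling.IsPileIn D P ∧ LozengeTiling.IsCompactPile P} B.pile ∧
      Set.BijOn LozengeTiling.PlanePartition.pile
        {A | A.BoundedBy B}
        {P | LozengeTiling.IsPileIn D P ∧ LozengeTiling.IsCompactPile P} ∧
      ∃ f : {A : LozengeTiling.PlanePartition // A.BoundedBy B} ≃
          {T : Set LozengeTiling.Lozenge // LozengeTiling.IsTiling D T},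
        ∀ A, LozengeTiling.CorrespondsTo D A.1.pile (f A).1) := by
  obtain ⟨Q, hQD⟩ := hD
  have hf := hQD.1
  have hQ := hQD.2.1
  obtain rfl := hQD.eq_domain
  obtain ⟨B, hB⟩ := exists_planePartition (maxPile_finite hf) (maxPile_compact hQ)
  have hle : ∀ A : PlanePartition, A.BoundedBy B ↔ A.pile ⊆ maxPile Q := fun A => by
    rw [← hB, PlanePartition.pile_subset_iff]
  refine ⟨fun P hP => ⟨?_, fun hc => ?_⟩, fun P hP => ?_, ?_, B, ?_, ?_, ?_, ?_⟩
  · rintro ⟨T, hT, hPT⟩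
    exact isCompactPile_of_correspondsTo hf hQ hP.1 hT hPT
  · have hPQ := (isPileIn_domain_iff hf hQ hc).1 hP
    exact ⟨_, isTiling_surface hf hQ hc hPQ, correspondsTo_surface hf hQ hc hPQ⟩
  · exact ⟨isFerrersDiagram_layer hP, isCompactPile_of_layer⟩
  · exact ⟨_, isTiling_surface hf hQ isCompactPile_empty (Set.empty_subset _),
      correspondsTo_surface hf hQ isCompactPile_empty (Set.empty_subset _),
      not_downFlip_surface_empty hf hQ⟩
  · rw [hB]
    refine ⟨maxPile_finite hf, maxPile_compact hQ, _, ?_, not_downFlip_surface_empty hf hQ,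
      (isTiling_surface hf hQ isCompactPile_empty (Set.empty_subset _)).2.symm⟩
    -- The greatest pile leaves no base square uncovered, so its visible faces are already its
    -- surface in the domain.
    rw [← surface_maxPile hf hQ]
    exact reflTransGen_downFlip hf hQ (maxPile_compact hQ) subset_rfl
  · rw [hB]
    exact ⟨⟨(isPileIn_domain_iff hf hQ (maxPile_compact hQ)).2 subset_rfl, maxPile_compact hQ⟩,
      fun P hP => (isPileIn_domain_iff hf hQ hP.2).1 hP.1⟩
  · refine ⟨fun A hA => ?_, PlanePartition.pile_injective.injOn, fun P hP => ?_⟩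
    · have hc := A.isCompactPile_pile
      exact ⟨(isPileIn_domain_iff hf hQ hc).2 ((hle A).1 hA), hc⟩
    · obtain ⟨A, rfl⟩ := exists_planePartition hP.1.1 hP.2
      exact ⟨A, (hle A).2 ((isPileIn_domain_iff hf hQ hP.2).1 hP.1), rfl⟩
  · refine ⟨Equiv.ofBijective (fun A => ⟨Square.toLozenge '' surface (domain Q) A.1.pile,
      isTiling_surface hf hQ A.1.isCompactPile_pile ((hle A.1).1 A.2)⟩) ⟨?_, ?_⟩,
      fun A => correspondsTo_surface hf hQ A.1.isCompactPile_pile ((hle A.1).1 A.2)⟩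
    · rintro ⟨A, hA⟩ ⟨A', hA'⟩ h
      exact Subtype.ext (PlanePartition.pile_injective (eq_of_image_surface_eq hf hQ
        A.isCompactPile_pile ((hle A).1 hA) A'.isCompactPile_pile ((hle A').1 hA')
        (Subtype.ext_iff.1 h)))
    · rintro ⟨T, hT⟩
      obtain ⟨P, hP, hPQ, rfl⟩ := exists_pile_of_isTiling hf hQ hT
      obtain ⟨A, rfl⟩ := exists_planePartition ((maxPile_finite hf).subset hPQ) hP
      exact ⟨⟨A, (hle A).2 hPQ⟩, rfl⟩
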